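/- Let $\mathcal M\subseteq B(H)$ be a II$_1$ factor (an infinite-dimensional von Neumann algebra with trivial centre and a faithful normal tracial state $\tau$). For self-adjoint $T\in\mathcal M$ let $m_T$ be its spectral distribution, the Borel probability measure on $\mathbb R$ with $\int f\,dm_T=\tau(f(T))$ for all compactly supported continuous $f$. Its eigenvalue function is $\lambda_s(T)=\inf\{t\in\mathbb R: m_T((t,\infty))\le s\}$, $s\in[0,1)$. For arbitrary $T\in\mathcal M$ the singular value function is $\mu_s(T)=\lambda_s(|T|)$. For self-adjoint $S,T$ write $S\prec T$ if $\int_0^t\lambda_s(S)\,ds\le\int_0^t\lambda_s(T)\,ds$ for all $t\in[0,1)$, with equality for $t=1$. For arbitrary $S,T$ write $S\prec_w T$ if $\int_0^t\mu_s(S)\,ds\le\int_0^t\mu_s(T)\,ds$ for all $t\in[0,1]$. With $\mathcal U(\mathcal M)$ the unitary group and closures in norm, put $$\mathcal O(T)=\overline{\{UTU^*: U\in\mathcal U(\mathcal M)\}},\qquad \mathcal N(T)=\overline{\{UTV: U,V\in\mathcal U(\mathcal M)\}}.$$ (1) Let $S,T\in\mathcal M$ with $T\ge 0$. If $\mu_s(S)=\mu_s(T)$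 for every $s\in[0,1)$ and $\tau(S)=\tau(T)$, then $S\ge 0$. (2) Let $\mathcal A$ be a maximal abelian self-adjoint subalgebra (MASA) of $\mathcal M$ and $E_{\mathcal A}:\mathcal M\to\mathcal A$ the normal conditional expectation. Thompson's theorem for $(\mathcal M,\mathcal A)$, that is, the assertion $$\text{for all } T\in\mathcal M,\ A\in\mathcal A:\quad A\prec_w T \iff \exists\, S\in\mathcal N(T)\ \text{ with } E_{\mathcal A}(S)=A,$$ implies Ravichandran's Schur–Horn theorem for $(\mathcal M,\mathcal A)$, that is, the assertion $$\text{for all self-adjoint } T\in\mathcal M,\ A\in\mathcal A:\quad A\prec T \iff \exists\, S\in\mathcal O(T)\ \text{ with } E_{\mathcal A}(S)=A.$$ In particular, Thompson's theorem for all II$_1$ factors and their MASAs implies Ravichandran's Schur–Horn theorem for all II$_1$ factors and their MASAs. -/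

import Mathlib

open scoped ComplexOrder CompactlySupported ENNReal

noncomputable section

namespace IIOne

variable {H : Type*} [NormedAddCommGroup H] [InnerProductSpace ℂ H] [CompleteSpace H]

/-- The elements of the von Neumann algebra `M`, with the algebraic operations, the norm and the
(Loewner) order of the bounded operators on `H`. -/
abbrev Elem (M : VonNeumannAlgebra H) : Type _ := M.toStarSubalgebra

theorem isClosed_carrier (M : VonNeumannAlgebra H) :
    IsClosed (M.toStarSubalgebra : Set (H →L[ℂ] H)) := by
  have h : (M.toStarSubalgebra : Set (H →L[ℂ] H))
      = Set.centralizer (Set.centralizer (M.toStarSubalgebra : Set (H →L[ℂ] H))) :=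
    M.centralizer_centralizer'.symm
  rw [h]
  exact Set.isClosed_centralizer _

/-- Continuous functional calculus for self-adjoint elements of a von Neumann algebra. -/
def fc {M : VonNeumannAlgebra H} (f : ℝ → ℝ) (T : Elem M) : Elem M :=
  ⟨cfc f (T : H →L[ℂ] H), by
    have : IsClosed (M.toStarSubalgebra : Set (H →L[ℂ] H)) := isClosed_carrier M
    exact cfc_mem (𝕜' := ℂ) f T.2⟩

/-- The absolute value `|T| = (T* T)^{1/2}`. -/
def absVal {M : VonNeumannAlgebra H} (T : Elem M) : Elem M :=
  fc Real.sqrt (star T * T)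

/-- A faithful normal tracial state on `M`. Normality is the preservation of suprema of
increasing nets. -/
structure Trace (M : VonNeumannAlgebra H) extends Elem M →ₗ[ℂ] ℂ where
  map_one' : toFun 1 = 1
  nonneg' : ∀ x : Elem M, 0 ≤ x → 0 ≤ toFun x
  faithful' : ∀ x : Elem M, 0 ≤ x → toFun x = 0 → x = 0
  tracial' : ∀ x y : Elem M, toFun (x * y) = toFun (y * x)
  normal' : ∀ (D : Set (Elem M)) (x : Elem M), D.Nonempty → DirectedOn (· ≤ ·) D → IsLUB D x →
    IsLUB ((fun y => (toFun y).re) '' D) (toFun x).re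

instance (M : VonNeumannAlgebra H) : CoeFun (Trace M) (fun _ => Elem M → ℂ) :=
  ⟨fun τ => τ.toLinearMap⟩

/-- `M` is a factor of type II₁: its centre consists of the scalars, it is infinite-dimensional,
and it has a faithful normal tracial state. -/
structure IsIIOneFactor (M : VonNeumannAlgebra H) : Prop where
  center_eq_bot : Subalgebra.center ℂ (Elem M) = ⊥
  infinite_dimensional : ¬ FiniteDimensional ℂ (Elem M)
  exists_trace : Nonempty (Trace M)

/-- `𝒜` is a maximal abelian self-adjoint subalgebra of `M`. -/
def IsMASA {M : VonNeumannAlgebra H} (𝒜 : StarSubalgebra ℂ (Elem M)) : Prop :=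
  Maximal (fun ℬ : StarSubalgebra ℂ (Elem M) => ∀ x ∈ ℬ, ∀ y ∈ ℬ, x * y = y * x) 𝒜

/-- `E` is a normal conditional expectation of `M` onto `𝒜`: a positive normal projection onto `𝒜`
that is `𝒜`-bimodular. -/
structure IsNormalCondExp {M : VonNeumannAlgebra H}
    (𝒜 : StarSubalgebra ℂ (Elem M)) (E : Elem M →ₗ[ℂ] 𝒜) : Prop where
  nonneg : ∀ x : Elem M, 0 ≤ x → 0 ≤ E x
  apply_coe : ∀ a : 𝒜, E (a : Elem M) = a
  bimodule : ∀ (a b : 𝒜) (x : Elem M), E ((a : Elem M) * x * (b : Elem M)) = a * E x * b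
  normal : ∀ (D : Set (Elem M)) (x : Elem M), D.Nonempty → DirectedOn (· ≤ ·) D → IsLUB D x →
    IsLUB (E '' D) (E x)

/-- The positive functional `f ↦ τ (f(T))` on the compactly supported continuous functions on
the real line, for `T` self-adjoint. -/
def spectralFunctional {M : VonNeumannAlgebra H} (τ : Trace M) (T : Elem M) :
    C_c(ℝ, ℝ) →ₚ[ℝ] ℝ :=
  PositiveLinearMap.mk₀
    { toFun := fun f => (τ (fc f T)).re
      map_add' := fun f g => by
        have h : fc (⇑(f + g)) T = fc f T + fc g T := by
          apply Subtype.ext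
          exact cfc_add (T : H →L[ℂ] H) f g f.continuous.continuousOn g.continuous.continuousOn
        rw [h, map_add, Complex.add_re]
      map_smul' := fun c f => by
        have h : fc (⇑(c • f)) T = (c : ℂ) • fc f T := by
          apply Subtype.ext
          exact (cfc_smul c f (T : H →L[ℂ] H) f.continuous.continuousOn).trans
            (Complex.coe_smul c _).symm
        rw [h, map_smul, smul_eq_mul, Complex.re_ofReal_mul]
        rfl }
    (fun f hf => by
      have h : (0 : Elem M) ≤ fc f T :=
        cfc_nonneg (a := (T : H →L[ℂ] H)) (fun x _ => hf x)
      exact (Complex.nonneg_iff.mp (τ.nonneg' _ h)).1)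

/-- The spectral distribution `m_T` of a self-adjoint `T`: the Borel measure on the real line
with `∫ f dm_T = τ (f(T))` for all compactly supported continuous `f`. -/
def spectralDistribution {M : VonNeumannAlgebra H} (τ : Trace M) (T : Elem M) :
    MeasureTheory.Measure ℝ :=
  RealRMK.rieszMeasure (spectralFunctional τ T)

/-- The eigenvalue function `λ_s(T)`, `s ∈ [0,1)`, of a self-adjoint `T`. -/
def eigenvalueFn {M : VonNeumannAlgebra H} (τ : Trace M) (T : Elem M) (s : ℝ) : ℝ :=
  sInf {t : ℝ | spectralDistribution τ T (Set.Ioi t) ≤ ENNReal.ofReal s}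

/-- The singular value function `μ_s(T) = λ_s(|T|)`, `s ∈ [0,1)`. -/
def singularValueFn {M : VonNeumannAlgebra H} (τ : Trace M) (T : Elem M) (s : ℝ) : ℝ :=
  eigenvalueFn τ (absVal T) s

/-- Majorization `S ≺ T` of self-adjoint elements. -/
def Majorized {M : VonNeumannAlgebra H} (τ : Trace M) (S T : Elem M) : Prop :=
  (∀ t ∈ Set.Ico (0 : ℝ) 1,
    ∫ s in (0 : ℝ)..t, eigenvalueFn τ S s ≤ ∫ s in (0 : ℝ)..t, eigenvalueFn τ T s) ∧
  ∫ s in (0 : ℝ)..1, eigenvalueFn τ S s = ∫ s in (0 : ℝ)..1, eigenvalueFn τ T s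

/-- (Absolute) submajorization `S ≺_w T`. -/
def Submajorized {M : VonNeumannAlgebra H} (τ : Trace M) (S T : Elem M) : Prop :=
  ∀ t ∈ Set.Icc (0 : ℝ) 1,
    ∫ s in (0 : ℝ)..t, singularValueFn τ S s ≤ ∫ s in (0 : ℝ)..t, singularValueFn τ T s

/-- The norm-closed unitary orbit of `T`. -/
def closedUnitaryOrbit {M : VonNeumannAlgebra H} (T : Elem M) : Set (Elem M) :=
  closure {X | ∃ U ∈ unitary (Elem M), X = U * T * star U}

/-- The norm-closed two-sided unitary orbit of `T`. -/
def closedTwoSidedUnitaryOrbit {M : VonNeumannAlgebra H} (T : Elem M) : Set (Elem M) :=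
  closure {X | ∃ U ∈ unitary (Elem M), ∃ V ∈ unitary (Elem M), X = U * T * V}

/-- The assertion of Thompson's theorem for the II₁ factor `M` with trace `τ`, the MASA `𝒜` and
the conditional expectation `E` onto `𝒜`. -/
def ThompsonTheorem {M : VonNeumannAlgebra H} (τ : Trace M)
    (𝒜 : StarSubalgebra ℂ (Elem M)) (E : Elem M →ₗ[ℂ] 𝒜) : Prop :=
  ∀ (T : Elem M) (A : 𝒜),
    Submajorized τ (A : Elem M) T ↔ ∃ S ∈ closedTwoSidedUnitaryOrbit T, E S = A

/-- The assertion of Ravichandran's Schur-Horn theorem for the II₁ factor `M` with trace `τ`, the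
MASA `𝒜` and the conditional expectation `E` onto `𝒜`. -/
def SchurHornTheorem {M : VonNeumannAlgebra H} (τ : Trace M)
    (𝒜 : StarSubalgebra ℂ (Elem M)) (E : Elem M →ₗ[ℂ] 𝒜) : Prop :=
  ∀ (T : Elem M) (A : 𝒜), IsSelfAdjoint T → IsSelfAdjoint A →
    (Majorized τ (A : Elem M) T ↔ ∃ S ∈ closedUnitaryOrbit T, E S = A)

end IIOne

end

namespace IIOne
open MeasureTheory

variable {H : Type*} [NormedAddCommGroup H] [InnerProductSpace ℂ H] [CompleteSpace H]
  {M : VonNeumannAlgebra H}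

-- Both parts rest on one rigidity fact, `Trace.eq_abs_of_re_apply_abs`: if `|S|` and `S` have
-- traces with the same real part, then `S = |S|`. It is the equality case of `Re τ(S) ≤ τ(|S|)`,
-- proved with the resolvent of `|S|` in place of a polar decomposition.
--
-- The eigenvalue function is the quantile function of the spectral distribution, so its integral
-- over `[0,1]` is the trace. In (1), equal singular values thus give `τ(|S|) = τ(T) = τ(S)`, and
-- rigidity applies.
--
-- For (2), adding a large scalar makes `T` and `A` positive, and submajorization then compares
-- eigenvalue functions. Thompson's theorem gives `S` in the two-sided orbit of the shifted `T` with
-- `E S` the shifted `A`. For positive `T`, `|UTV| = V*TV`, so `|S|` lies in the one-sided orbit and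
-- has the trace of the shifted `T`. Since `E` preserves the trace, so does `S`; rigidity gives `S =
-- |S|`, and the shift is undone.

-- Functional calculus and order inside `M`

scoped instance isClosed_toStarSubalgebra (M : VonNeumannAlgebra H) :
    IsClosed (M.toStarSubalgebra : Set (H →L[ℂ] H)) := isClosed_carrier M

theorem coe_cfc (f : ℝ → ℝ) {T : Elem M} (hT : IsSelfAdjoint T)
    (hf : Continuous f) : ((cfc f T : Elem M) : H →L[ℂ] H) = cfc f (T : H →L[ℂ] H) :=
  StarAlgHomClass.map_cfc (S := ℂ) M.toStarSubalgebra.subtype f T hf.continuousOn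
    continuous_subtype_val hT (congrArg Subtype.val hT)

theorem fc_eq_cfc {f : ℝ → ℝ} {T : Elem M} (hT : IsSelfAdjoint T) (hf : Continuous f) :
    fc f T = cfc f T :=
  Subtype.ext (coe_cfc f hT hf).symm

/-- The square root of a positive element stays in the norm-closed algebra `M`, so the order
inherited from `B(H)` is the intrinsic C*-order of `M`. -/
instance starOrderedRing_elem : StarOrderedRing (Elem M) :=
  StarOrderedRing.of_nonneg_iff' (fun {x y} h z => add_le_add_right (α := H →L[ℂ] H) h z) (by
    intro x
    constructor
    · intro hx
      have hx' : (0 : H →L[ℂ] H) ≤ x := hx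
      have hsa : IsSelfAdjoint (fc Real.sqrt x) :=
        Subtype.ext (cfc_predicate Real.sqrt (x : H →L[ℂ] H))
      refine ⟨fc Real.sqrt x, ?_⟩
      rw [hsa.star_eq]
      apply Subtype.ext
      change (x : H →L[ℂ] H) = cfc Real.sqrt (x : H →L[ℂ] H) * cfc Real.sqrt (x : H →L[ℂ] H)
      rw [← cfcₙ_eq_cfc (Real.continuous_sqrt.continuousOn) Real.sqrt_zero,
        ← CFC.sqrt_eq_real_sqrt _ hx', CFC.sqrt_mul_sqrt_self _ hx']
    · rintro ⟨s, rfl⟩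
      exact star_mul_self_nonneg (s : H →L[ℂ] H))

/-! ### The trace and the rigidity of `τ(|S|) = τ(S)` -/

namespace Trace

variable (τ : Trace M)

/-- A trace as a positive linear map. -/
noncomputable def toPositive : Elem M →ₚ[ℂ] ℂ := PositiveLinearMap.mk₀ τ.toLinearMap τ.nonneg'

theorem exists_norm_apply_le : ∃ C : ℝ, ∀ x : Elem M, ‖τ x‖ ≤ C * ‖x‖ :=
  let ⟨C, hC⟩ := PositiveLinearMap.exists_norm_apply_le τ.toPositive
  ⟨C, hC⟩

theorem apply_star (x : Elem M) : τ (star x) = star (τ x) := map_star τ.toPositive x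

theorem re_apply_star (x : Elem M) : (τ (star x)).re = (τ x).re := by
  rw [apply_star]; rfl

theorem continuous_apply : Continuous (fun x : Elem M => τ x) := by
  obtain ⟨C, hC⟩ := τ.exists_norm_apply_le
  exact AddMonoidHomClass.continuous_of_bound τ.toLinearMap C hC

theorem re_nonneg {x : Elem M} (hx : 0 ≤ x) : 0 ≤ (τ x).re :=
  (Complex.nonneg_iff.mp (τ.nonneg' x hx)).1

theorem im_of_nonneg {x : Elem M} (hx : 0 ≤ x) : (τ x).im = 0 :=
  (Complex.nonneg_iff.mp (τ.nonneg' x hx)).2.symm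

theorem apply_mul_comm (x y : Elem M) : τ (x * y) = τ (y * x) := τ.tracial' x y

theorem apply_one : τ (1 : Elem M) = 1 := τ.map_one'

/-- With `y = s*s`, the trace property turns `τ(xy)` into `τ(s x s*)`. -/
theorem re_mul_nonneg {x y : Elem M} (hx : 0 ≤ x) (hy : 0 ≤ y) : 0 ≤ (τ (x * y)).re := by
  obtain ⟨s, rfl⟩ := CStarAlgebra.nonneg_iff_eq_star_mul_self.mp hy
  rw [← mul_assoc, apply_mul_comm, ← mul_assoc]
  exact τ.re_nonneg (star_right_conjugate_nonneg hx s)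

theorem eq_zero_of_re {x : Elem M} (hx : 0 ≤ x) (h : (τ x).re = 0) : x = 0 :=
  τ.faithful' x hx (Complex.ext h (τ.im_of_nonneg hx))

theorem nontrivial (τ : Trace M) : Nontrivial (Elem M) :=
  ⟨1, 0, fun h => by simpa [h] using τ.apply_one⟩

theorem apply_conj {U : Elem M} (hU : U ∈ unitary (Elem M)) (x : Elem M) :
    τ (U * x * star U) = τ x := by
  rw [apply_mul_comm, ← mul_assoc, Unitary.star_mul_self_of_mem hU, one_mul]

theorem apply_algebraMap (c : ℝ) : τ (algebraMap ℝ (Elem M) c) = c := by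
  rw [Algebra.algebraMap_eq_smul_one, ← Complex.coe_smul, map_smul, apply_one, smul_eq_mul, mul_one]

set_option maxHeartbeats 1000000 in
/-- An element whose absolute value has the same (real) trace is positive. -/
theorem eq_abs_of_re_apply_abs {S : Elem M} (h : (τ (CFC.abs S)).re = (τ S).re) :
    S = CFC.abs S := by
  set Q := CFC.abs S with hQ
  have hQ0 : 0 ≤ Q := CFC.abs_nonneg S
  have hQs : star Q = Q := (IsSelfAdjoint.of_nonneg hQ0).star_eq
  have hQQ : Q * Q = star S * S := CFC.abs_mul_abs S
  obtain ⟨C, hC⟩ := τ.exists_norm_apply_le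
  set N := star (S - Q) * (S - Q) with hN
  have hN0 : 0 ≤ N := star_mul_self_nonneg _
  have hNe : N = 2 • (Q * Q) - star S * Q - Q * S := by
    rw [hN, star_sub, hQs, sub_mul, mul_sub, mul_sub, ← hQQ]; abel
  have hspec : ∀ x ∈ spectrum ℝ Q, 0 ≤ x := fun x hx => spectrum_nonneg_of_nonneg hQ0 hx
  have hspec' : ∀ x ∈ spectrum ℝ Q, x ≤ ‖Q‖ := fun x hx =>
    haveI := τ.nontrivial
    (le_abs_self x).trans (spectrum.norm_le_norm_of_mem hx)
  -- Weight `N` by `P = (Q + ε)⁻¹`. As `ε ≤ 1`, `P ≥ (‖Q‖ + 1)⁻¹`, so `τ(NP)` controls `τ(N)`. Since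
  -- `QP = 1 - εP`, the trace of `NP` has real part `2(τ(Q) - Re τ(S)) + 2ε(Re τ(SP) - τ(QP))`; the
  -- first bracket vanishes by hypothesis.
  have main : ∀ ε : ℝ, 0 < ε → ε ≤ 1 → (τ N).re ≤ (‖Q‖ + 1) * (2 * ε * C) := by
    intro ε hε hε1
    have hcont : ContinuousOn (fun x : ℝ => (x + ε)⁻¹) (spectrum ℝ Q) :=
      ContinuousOn.inv₀ (by fun_prop) fun x hx => by have := hspec x hx; positivity
    set P := cfc (fun x : ℝ => (x + ε)⁻¹) Q with hP
    have hPs : star P = P := (cfc_predicate (fun x : ℝ => (x + ε)⁻¹) Q : IsSelfAdjoint _)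
    have hQP : Q * P = cfc (fun x : ℝ => x * (x + ε)⁻¹) Q := by
      rw [cfc_mul (fun x : ℝ => x) _ Q (by fun_prop) hcont, cfc_id' ℝ Q]
    have hQP' : Q * P = 1 - ε • P := by
      rw [hQP, ← cfc_smul ε _ Q hcont, ← cfc_one ℝ Q,
        ← cfc_sub (1 : ℝ → ℝ) (fun x => ε • (x + ε)⁻¹) Q continuousOn_const (hcont.const_smul ε)]
      refine cfc_congr fun x hx => ?_
      have := hspec x hx
      simp only [Pi.one_apply, smul_eq_mul]
      field_simp
      ring
    have hP0 : algebraMap ℝ (Elem M) (‖Q‖ + 1)⁻¹ ≤ P := by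
      refine algebraMap_le_cfc _ _ Q (fun x hx => ?_) hcont
      have := hspec x hx
      have := hspec' x hx
      gcongr
    have h1 : (‖Q‖ + 1)⁻¹ * (τ N).re ≤ (τ (N * P)).re := by
      have := τ.re_mul_nonneg hN0 (sub_nonneg.mpr hP0)
      rw [mul_sub, map_sub, Algebra.algebraMap_eq_smul_one, mul_smul_comm, mul_one,
        ← Complex.coe_smul, map_smul, smul_eq_mul, Complex.sub_re, Complex.re_ofReal_mul] at this
      linarith
    -- `SP` and `QP` have the same modulus because `Q² = S*S`, and `QP` is a contraction as `x/(x +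
    -- ε) ≤ 1`.
    have hSP : ‖S * P‖ ≤ 1 := by
      have e : star (S * P) * (S * P) = star (Q * P) * (Q * P) := by
        rw [star_mul, star_mul, mul_assoc, ← mul_assoc (star S), ← hQQ, hQs]
        simp only [mul_assoc]
      have e' : ‖S * P‖ * ‖S * P‖ = ‖Q * P‖ * ‖Q * P‖ := by
        rw [← CStarRing.norm_star_mul_self, e, CStarRing.norm_star_mul_self]
      have : ‖Q * P‖ ≤ 1 := by
        rw [hQP]
        refine norm_cfc_le zero_le_one fun x hx => ?_
        have := hspec x hx
        rw [Real.norm_of_nonneg (by positivity), ← div_eq_mul_inv]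
        exact div_le_one_of_le₀ (by linarith) (by positivity)
      nlinarith [norm_nonneg (S * P), norm_nonneg (Q * P)]
    have hSPb : (τ (S * P)).re ≤ C := by
      have h0 : 0 ≤ C := by
        have := (norm_nonneg _).trans (hC 1)
        nlinarith [norm_nonneg (1 : Elem M), hC 1, (by rw [τ.apply_one, norm_one] : ‖τ 1‖ = 1)]
      calc (τ (S * P)).re ≤ ‖τ (S * P)‖ := Complex.re_le_norm _
        _ ≤ C * ‖S * P‖ := hC _
        _ ≤ C * 1 := by gcongr
        _ = C := mul_one C
    have hQPnn : 0 ≤ (τ (Q * P)).re := by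
      refine τ.re_mul_nonneg hQ0 (le_trans ?_ hP0)
      rw [Algebra.algebraMap_eq_smul_one]
      exact smul_nonneg (by positivity) zero_le_one
    have h2 : (τ (N * P)).re ≤ 2 * ε * C := by
      have e1 : (τ (Q * Q * P)).re = (τ Q).re - ε * (τ (Q * P)).re := by
        rw [mul_assoc, hQP', mul_sub, mul_one, mul_smul_comm, map_sub, ← Complex.coe_smul, map_smul,
          smul_eq_mul, Complex.sub_re, Complex.re_ofReal_mul, hQP']
      have e2 : (τ (star S * Q * P)).re = (τ S).re - ε * (τ (S * P)).re := by
        rw [mul_assoc, hQP', mul_sub, mul_one, mul_smul_comm, map_sub, ← Complex.coe_smul, map_smul,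
          smul_eq_mul, Complex.sub_re, Complex.re_ofReal_mul, re_apply_star,
          apply_mul_comm, ← re_apply_star τ (S * P), star_mul, hPs]
      have e3 : (τ (Q * S * P)).re = (τ S).re - ε * (τ (S * P)).re := by
        rw [← e2, ← re_apply_star, star_mul, star_mul, hQs, hPs, apply_mul_comm]
      rw [hNe, sub_mul, sub_mul, map_sub, map_sub, Complex.sub_re, Complex.sub_re, e2, e3,
        smul_mul_assoc, two_nsmul, map_add, Complex.add_re, e1, h]
      nlinarith
    have h3 : (0 : ℝ) < ‖Q‖ + 1 := by positivity
    calc (τ N).re = (‖Q‖ + 1) * ((‖Q‖ + 1)⁻¹ * (τ N).re) := by field_simp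
      _ ≤ (‖Q‖ + 1) * (2 * ε * C) := mul_le_mul_of_nonneg_left (h1.trans h2) h3.le
  have hN' : (τ N).re ≤ 0 := by
    have hlim : Filter.Tendsto (fun ε : ℝ => (‖Q‖ + 1) * (2 * ε * C)) (nhdsWithin 0 (Set.Ioi 0))
        (nhds ((‖Q‖ + 1) * (2 * 0 * C))) :=
      (Continuous.tendsto (by fun_prop) 0).mono_left nhdsWithin_le_nhds
    rw [mul_zero, zero_mul, mul_zero] at hlim
    refine ge_of_tendsto hlim ?_
    filter_upwards [Ioc_mem_nhdsGT (zero_lt_one' ℝ)] with ε hε using main ε hε.1 hε.2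
  have := τ.eq_zero_of_re hN0 (le_antisymm hN' (τ.re_nonneg hN0))
  exact sub_eq_zero.mp (CStarRing.star_mul_self_eq_zero_iff _ |>.mp this)

end Trace

/-! ### Quantile functions of probability measures on the line -/

/-- The quantile function of a measure on the real line, counted from above. -/
noncomputable def upperQuantile (μ : Measure ℝ) (s : ℝ) : ℝ :=
  sInf {t : ℝ | μ (Set.Ioi t) ≤ ENNReal.ofReal s}

section Quantile

variable (μ : Measure ℝ)

theorem tendsto_measure_Ioi_atTop [IsFiniteMeasure μ] :
    Filter.Tendsto (fun t : ℝ => μ (Set.Ioi t)) Filter.atTop (nhds 0) := by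
  have h := tendsto_measure_iInter_atTop (μ := μ) (s := fun t : ℝ => Set.Ioi t)
    (fun t => measurableSet_Ioi.nullMeasurableSet) (fun a b hab => Set.Ioi_subset_Ioi hab)
    ⟨0, measure_ne_top _ _⟩
  have e : (⋂ t : ℝ, Set.Ioi t) = ∅ :=
    Set.eq_empty_of_forall_notMem fun x hx => lt_irrefl x (Set.mem_iInter.mp hx x)
  rwa [e, measure_empty] at h

theorem tendsto_measure_Ioi_atBot [IsProbabilityMeasure μ] :
    Filter.Tendsto (fun t : ℝ => μ (Set.Ioi t)) Filter.atBot (nhds 1) := by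
  have h := tendsto_measure_iUnion_atBot (μ := μ) (s := fun t : ℝ => Set.Ioi t)
    (fun a b hab => Set.Ioi_subset_Ioi hab)
  have e : (⋃ t : ℝ, Set.Ioi t) = Set.univ :=
    Set.eq_univ_of_forall fun x => Set.mem_iUnion.mpr ⟨x - 1, by simp⟩
  rwa [e, measure_univ] at h

/-- The infimum is attained because `t ↦ μ (t, ∞)` is right-continuous. The endpoints are excluded:
the set may be empty at `s = 0` and is all of `ℝ` at `s = 1`, where `sInf` takes a default value. -/
theorem upperQuantile_le_iff [IsProbabilityMeasure μ] {s t : ℝ} (hs : s ∈ Set.Ioo (0 : ℝ) 1) :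
    upperQuantile μ s ≤ t ↔ μ (Set.Ioi t) ≤ ENNReal.ofReal s := by
  have hbdd : BddBelow {t : ℝ | μ (Set.Ioi t) ≤ ENNReal.ofReal s} := by
    have hlt : ENNReal.ofReal s < 1 := by
      rw [← ENNReal.ofReal_one]; exact (ENNReal.ofReal_lt_ofReal_iff one_pos).mpr hs.2
    obtain ⟨a, ha⟩ := ((tendsto_measure_Ioi_atBot μ).eventually (lt_mem_nhds hlt)).exists
    refine ⟨a, fun t ht => le_of_lt (not_le.mp fun h => ?_)⟩
    exact absurd (ha.trans_le ((measure_mono (Set.Ioi_subset_Ioi h)).trans ht)) (lt_irrefl _)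
  have hne : {t : ℝ | μ (Set.Ioi t) ≤ ENNReal.ofReal s}.Nonempty := by
    obtain ⟨a, ha⟩ := ((tendsto_measure_Ioi_atTop μ).eventually
      (gt_mem_nhds (ENNReal.ofReal_pos.mpr hs.1))).exists
    exact ⟨a, ha.le⟩
  refine ⟨fun h => ?_, fun h => csInf_le hbdd h⟩
  have hu : Set.Ioi t = ⋃ n : ℕ, Set.Ioi (t + 1 / ((n : ℝ) + 1)) := by
    ext x
    simp only [Set.mem_Ioi, Set.mem_iUnion]
    constructor
    · intro hx
      obtain ⟨n, hn⟩ := exists_nat_one_div_lt (sub_pos.mpr hx)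
      exact ⟨n, by linarith⟩
    · rintro ⟨n, hn⟩
      have : (0 : ℝ) < 1 / ((n : ℝ) + 1) := by positivity
      linarith
  have hmono : Monotone fun n : ℕ => Set.Ioi (t + 1 / ((n : ℝ) + 1)) := fun m n hmn =>
    Set.Ioi_subset_Ioi (by gcongr)
  rw [hu, hmono.measure_iUnion]
  refine iSup_le fun n => ?_
  have hlt : upperQuantile μ s < t + 1 / ((n : ℝ) + 1) :=
    h.trans_lt (lt_add_of_pos_right _ (by positivity))
  obtain ⟨b, hb, hbt⟩ := (csInf_lt_iff hbdd hne).mp hlt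
  exact (measure_mono (Set.Ioi_subset_Ioi hbt.le)).trans hb

theorem antitoneOn_upperQuantile [IsProbabilityMeasure μ] :
    AntitoneOn (upperQuantile μ) (Set.Ioo 0 1) := fun s hs s' hs' h => by
  rw [upperQuantile_le_iff μ hs']
  exact ((upperQuantile_le_iff μ hs).mp le_rfl).trans (ENNReal.ofReal_le_ofReal h)

theorem aemeasurable_upperQuantile [IsProbabilityMeasure μ] :
    AEMeasurable (upperQuantile μ) (volume.restrict (Set.Ioo (0 : ℝ) 1)) :=
  aemeasurable_restrict_of_antitoneOn measurableSet_Ioo (antitoneOn_upperQuantile μ)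

/-- The quantile function transports the uniform distribution to the given measure. -/
theorem map_upperQuantile [IsProbabilityMeasure μ] :
    (volume.restrict (Set.Ioo (0 : ℝ) 1)).map (upperQuantile μ) = μ := by
  symm
  refine Measure.ext_of_Iic _ _ fun t => ?_
  rw [Measure.map_apply_of_aemeasurable (aemeasurable_upperQuantile μ) measurableSet_Iic]
  -- Within `(0,1)`, the quantile is at most `t` exactly from `s = μ (t, ∞)` on, a set of length `1
  -- - μ (t, ∞) = μ (-∞, t]`.
  have e : (upperQuantile μ ⁻¹' Set.Iic t) ∩ Set.Ioo 0 1
      = Set.Ici (μ.real (Set.Ioi t)) ∩ Set.Ioo 0 1 := by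
    ext s
    simp only [Set.mem_inter_iff, Set.mem_preimage, Set.mem_Iic, Set.mem_Ici]
    refine and_congr_left fun hs => ?_
    rw [upperQuantile_le_iff μ hs, ← ofReal_measureReal, ENNReal.ofReal_le_ofReal_iff hs.1.le]
  have hm0 : 0 ≤ μ.real (Set.Ioi t) := measureReal_nonneg
  have hvol : volume (Set.Ici (μ.real (Set.Ioi t)) ∩ Set.Ioo 0 1)
      = ENNReal.ofReal (1 - μ.real (Set.Ioi t)) := by
    apply le_antisymm
    · rw [← Real.volume_Icc]
      exact measure_mono fun s hs => ⟨hs.1, hs.2.2.le⟩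
    · rw [← Real.volume_Ioo]
      exact measure_mono fun s hs => ⟨hs.1.le, hm0.trans_lt hs.1, hs.2⟩
  rw [Measure.restrict_apply' measurableSet_Ioo, e, hvol, ENNReal.ofReal_sub _ hm0,
    ofReal_measureReal, ENNReal.ofReal_one, ← Set.compl_Ioi, prob_compl_eq_one_sub measurableSet_Ioi]

theorem intervalIntegrable_upperQuantile [IsProbabilityMeasure μ] (h : Integrable id μ) {t : ℝ}
    (ht : t ∈ Set.Icc (0 : ℝ) 1) : IntervalIntegrable (upperQuantile μ) volume 0 t := by
  have h1 : Integrable (upperQuantile μ) (volume.restrict (Set.Ioo (0 : ℝ) 1)) := by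
    rw [← map_upperQuantile μ] at h
    exact h.comp_aemeasurable (aemeasurable_upperQuantile μ)
  rw [intervalIntegrable_iff_integrableOn_Ioo_of_le ht.1]
  exact IntegrableOn.mono_set h1 (Set.Ioo_subset_Ioo_right ht.2)

theorem integral_upperQuantile [IsProbabilityMeasure μ] :
    ∫ s in (0 : ℝ)..1, upperQuantile μ s = ∫ x, x ∂μ := by
  conv_rhs => rw [← map_upperQuantile μ]
  rw [integral_map (f := fun x : ℝ => x) (aemeasurable_upperQuantile μ) aestronglyMeasurable_id,
    intervalIntegral.integral_of_le zero_le_one, integral_Ioc_eq_integral_Ioo]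

theorem upperQuantile_map_add [IsProbabilityMeasure μ] (c : ℝ) {s : ℝ}
    (hs : s ∈ Set.Ioo (0 : ℝ) 1) :
    upperQuantile (μ.map (· + c)) s = upperQuantile μ s + c := by
  have : IsProbabilityMeasure (μ.map (· + c)) :=
    Measure.isProbabilityMeasure_map (by fun_prop)
  refine eq_of_forall_ge_iff fun t => ?_
  rw [upperQuantile_le_iff _ hs, ← le_sub_iff_add_le, upperQuantile_le_iff _ hs,
    Measure.map_apply (by fun_prop) measurableSet_Ioi]
  simp [Set.preimage_add_const_Ioi]

end Quantile

/-! ### Spectral distributions, eigenvalue functions and the trace -/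

section SpectralDistribution

variable (τ : Trace M)

instance regular_spectralDistribution (X : Elem M) : (spectralDistribution τ X).Regular :=
  RealRMK.regular_rieszMeasure _

theorem spectralFunctional_apply {X : Elem M} (hX : IsSelfAdjoint X) (f : C_c(ℝ, ℝ)) :
    spectralFunctional τ X f = (τ (cfc f X)).re := by
  rw [← fc_eq_cfc hX (map_continuous f)]
  rfl

theorem spectrum_subset_Icc (τ : Trace M) {X : Elem M} :
    spectrum ℝ X ⊆ Set.Icc (-‖X‖) ‖X‖ := fun x hx => by
  have := τ.nontrivial
  exact abs_le.mp (spectrum.norm_le_norm_of_mem hx)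

theorem spectralDistribution_compl_Icc {X : Elem M} (hX : IsSelfAdjoint X) :
    spectralDistribution τ X (Set.Icc (-‖X‖) ‖X‖)ᶜ = 0 := by
  -- By inner regularity only compact sets off the interval matter; a bump function there vanishes
  -- on the spectrum, so its functional calculus is zero.
  rw [isClosed_Icc.isOpen_compl.measure_eq_iSup_isCompact, ← nonpos_iff_eq_zero]
  refine iSup_le fun K => iSup_le fun hK => iSup_le fun hKc => ?_
  obtain ⟨f, hf1, hf0, hfc, hf⟩ := exists_continuous_one_zero_of_isCompact hKc
    (isClosed_Icc (a := -‖X‖) (b := ‖X‖)) (Set.disjoint_left.mpr fun x hx => hK hx)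
  have hle := RealRMK.rieszMeasure_le_of_eq_one (spectralFunctional τ X) (f := ⟨f, hfc⟩)
    (fun x => (hf x).1) hKc (fun x hx => hf1 hx)
  have h0 : cfc (⇑(⟨f, hfc⟩ : C_c(ℝ, ℝ))) X = 0 := by
    rw [← cfc_zero ℝ X]
    exact cfc_congr fun x hx => hf0 (spectrum_subset_Icc τ hx)
  rwa [spectralFunctional_apply τ hX, h0, map_zero, Complex.zero_re, ENNReal.ofReal_zero] at hle

theorem integral_spectralDistribution {X : Elem M} (hX : IsSelfAdjoint X) {f : ℝ → ℝ}
    (hf : Continuous f) :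
    ∫ x, f x ∂(spectralDistribution τ X) = (τ (cfc f X)).re := by
  -- The cutoff `g` makes `f` compactly supported without changing it on the spectrum or almost
  -- everywhere. This admits `f = 1` and `f = id`.
  obtain ⟨g, hg1, -, hgc, -⟩ := exists_continuous_one_zero_of_isCompact
    (isCompact_Icc (a := -‖X‖) (b := ‖X‖)) isClosed_empty (Set.disjoint_empty _)
  have hc : HasCompactSupport (fun x => f x * g x) := hgc.mul_left
  have hae : f =ᵐ[spectralDistribution τ X] fun x => f x * g x := by
    refine measure_mono_null (fun x hx => ?_) (spectralDistribution_compl_Icc τ hX)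
    exact fun hx' => hx (by simp [hg1 hx'])
  have hcfc : cfc f X = cfc (fun x => f x * g x) X :=
    cfc_congr fun x hx => by simp [hg1 (spectrum_subset_Icc τ hx)]
  rw [integral_congr_ae hae, hcfc]
  exact (RealRMK.integral_rieszMeasure (spectralFunctional τ X)
    ⟨⟨fun x => f x * g x, by fun_prop⟩, hc⟩).trans (spectralFunctional_apply τ hX _)

theorem isProbabilityMeasure_spectralDistribution {X : Elem M} (hX : IsSelfAdjoint X) :
    IsProbabilityMeasure (spectralDistribution τ X) := by
  have h := integral_spectralDistribution τ hX (continuous_const (y := (1 : ℝ)))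
  rw [cfc_const_one ℝ X, τ.apply_one, Complex.one_re, integral_const, smul_eq_mul, mul_one,
    measureReal_def, ENNReal.toReal_eq_one_iff] at h
  exact ⟨h⟩

theorem integrable_id_spectralDistribution {X : Elem M} (hX : IsSelfAdjoint X) :
    Integrable id (spectralDistribution τ X) := by
  have := isProbabilityMeasure_spectralDistribution τ hX
  refine Integrable.of_bound aestronglyMeasurable_id ‖X‖ ?_
  refine measure_mono_null (fun x hx => ?_) (spectralDistribution_compl_Icc τ hX)
  exact fun hx' => hx (abs_le.mpr hx')

theorem spectralDistribution_add_algebraMap {X : Elem M} (hX : IsSelfAdjoint X) (c : ℝ) :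
    spectralDistribution τ (X + algebraMap ℝ (Elem M) c)
      = (spectralDistribution τ X).map (· + c) := by
  have hXc : IsSelfAdjoint (X + algebraMap ℝ (Elem M) c) :=
    hX.add (IsSelfAdjoint.algebraMap _ (IsSelfAdjoint.all c))
  have := isProbabilityMeasure_spectralDistribution τ hX
  have : IsProbabilityMeasure ((spectralDistribution τ X).map (· + c)) :=
    Measure.isProbabilityMeasure_map (by fun_prop)
  refine Measure.ext_of_integral_eq_on_compactlySupported fun f => ?_
  have e : X + algebraMap ℝ (Elem M) c = cfc (fun x : ℝ => x + c) X := by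
    rw [cfc_add_const c (fun x : ℝ => x) X, cfc_id' ℝ X]
  rw [integral_spectralDistribution τ hXc (map_continuous f),
    integral_map (by fun_prop) (map_continuous f).aestronglyMeasurable,
    integral_spectralDistribution τ hX (f := fun x => f (x + c))
      ((map_continuous f).comp (by fun_prop)), e, ← cfc_comp f (fun x : ℝ => x + c) X hX
      (map_continuous f).continuousOn (by fun_prop)]
  rfl

theorem intervalIntegrable_eigenvalueFn {X : Elem M} (hX : IsSelfAdjoint X) {t : ℝ}
    (ht : t ∈ Set.Icc (0 : ℝ) 1) : IntervalIntegrable (eigenvalueFn τ X) volume 0 t :=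
  have := isProbabilityMeasure_spectralDistribution τ hX
  intervalIntegrable_upperQuantile _ (integrable_id_spectralDistribution τ hX) ht

theorem integral_eigenvalueFn {X : Elem M} (hX : IsSelfAdjoint X) :
    ∫ s in (0 : ℝ)..1, eigenvalueFn τ X s = (τ X).re := by
  have := isProbabilityMeasure_spectralDistribution τ hX
  have h := integral_spectralDistribution τ hX continuous_id
  rw [cfc_id ℝ X] at h
  exact (integral_upperQuantile _).trans h

theorem integral_eigenvalueFn_add_algebraMap {X : Elem M} (hX : IsSelfAdjoint X) (c : ℝ) {t : ℝ}
    (ht : t ∈ Set.Icc (0 : ℝ) 1) :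
    ∫ s in (0 : ℝ)..t, eigenvalueFn τ (X + algebraMap ℝ (Elem M) c) s
      = (∫ s in (0 : ℝ)..t, eigenvalueFn τ X s) + t * c := by
  have := isProbabilityMeasure_spectralDistribution τ hX
  have e : ∫ s in (0 : ℝ)..t, eigenvalueFn τ (X + algebraMap ℝ (Elem M) c) s
      = ∫ s in (0 : ℝ)..t, (eigenvalueFn τ X s + c) := by
    rw [intervalIntegral.integral_of_le ht.1, intervalIntegral.integral_of_le ht.1,
      integral_Ioc_eq_integral_Ioo, integral_Ioc_eq_integral_Ioo]
    refine setIntegral_congr_fun measurableSet_Ioo fun s hs => ?_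
    change upperQuantile (spectralDistribution τ (X + algebraMap ℝ (Elem M) c)) s
      = upperQuantile (spectralDistribution τ X) s + c
    rw [spectralDistribution_add_algebraMap τ hX c]
    exact upperQuantile_map_add _ c ⟨hs.1, hs.2.trans_le ht.2⟩
  rw [e, intervalIntegral.integral_add (intervalIntegrable_eigenvalueFn τ hX ht)
    intervalIntegrable_const, intervalIntegral.integral_const, smul_eq_mul, sub_zero]

theorem absVal_eq_abs (T : Elem M) : absVal T = CFC.abs T := by
  rw [absVal, fc_eq_cfc (IsSelfAdjoint.star_mul_self T) Real.continuous_sqrt, CFC.abs,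
    CFC.sqrt_eq_real_sqrt _ (star_mul_self_nonneg T),
    cfcₙ_eq_cfc Real.continuous_sqrt.continuousOn Real.sqrt_zero]

theorem singularValueFn_of_nonneg {X : Elem M} (hX : 0 ≤ X) :
    singularValueFn τ X = eigenvalueFn τ X := by
  funext s
  rw [singularValueFn, absVal_eq_abs, CFC.abs_of_nonneg X hX]

theorem integral_singularValueFn (X : Elem M) :
    ∫ s in (0 : ℝ)..1, singularValueFn τ X s = (τ (CFC.abs X)).re := by
  rw [← integral_eigenvalueFn τ (IsSelfAdjoint.of_nonneg (CFC.abs_nonneg X)), ← absVal_eq_abs]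
  rfl

end SpectralDistribution

/-! ### Positivity from singular values and trace -/

variable (τ : Trace M)

theorem nonneg_of_singularValueFn_eq {S T : Elem M} (hT : 0 ≤ T)
    (hμ : ∀ s ∈ Set.Ico (0 : ℝ) 1, singularValueFn τ S s = singularValueFn τ T s)
    (hτ : τ S = τ T) : 0 ≤ S := by
  have h : (τ (CFC.abs S)).re = (τ S).re := by
    rw [hτ, ← CFC.abs_of_nonneg T hT, ← integral_singularValueFn, ← integral_singularValueFn,
      intervalIntegral.integral_of_le zero_le_one, intervalIntegral.integral_of_le zero_le_one,
      integral_Ioc_eq_integral_Ioo, integral_Ioc_eq_integral_Ioo]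
    exact setIntegral_congr_fun measurableSet_Ioo fun s hs => hμ s ⟨hs.1.le, hs.2⟩
  rw [τ.eq_abs_of_re_apply_abs h]
  exact CFC.abs_nonneg S

theorem add_algebraMap_nonneg {X : Elem M} (hX : IsSelfAdjoint X) {c : ℝ} (hc : ‖X‖ ≤ c) :
    0 ≤ X + algebraMap ℝ (Elem M) c := by
  have h1 := hX.neg_algebraMap_norm_le_self
  have h2 : algebraMap ℝ (Elem M) ‖X‖ ≤ algebraMap ℝ (Elem M) c := by
    rw [← sub_nonneg, ← map_sub, Algebra.algebraMap_eq_smul_one]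
    exact smul_nonneg (sub_nonneg.mpr hc) zero_le_one
  exact (neg_le_iff_add_nonneg.mp h1).trans (add_le_add_right h2 X)

/-! ### Unitary orbits under shifts and absolute values -/

section Orbits

variable {T S : Elem M}

theorem mem_closedTwoSidedUnitaryOrbit_self (T : Elem M) : T ∈ closedTwoSidedUnitaryOrbit T :=
  subset_closure ⟨1, one_mem _, 1, one_mem _, by simp⟩

theorem closedUnitaryOrbit_subset (T : Elem M) :
    closedUnitaryOrbit T ⊆ closedTwoSidedUnitaryOrbit T :=
  closure_mono fun _ ⟨U, hU, h⟩ => ⟨U, hU, star U, Unitary.star_mem hU, h⟩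

theorem apply_eq_of_mem_closedUnitaryOrbit (hS : S ∈ closedUnitaryOrbit T) : τ S = τ T := by
  refine closure_minimal ?_ (isClosed_eq τ.continuous_apply continuous_const) hS
  rintro X ⟨U, hU, rfl⟩
  exact τ.apply_conj hU T

theorem conj_add_algebraMap {U : Elem M} (hU : U ∈ unitary (Elem M)) (T : Elem M) (c : ℝ) :
    U * (T + algebraMap ℝ (Elem M) c) * star U = U * T * star U + algebraMap ℝ (Elem M) c := by
  rw [mul_add, add_mul, ← Algebra.commutes, mul_assoc (algebraMap ℝ (Elem M) c),
    Unitary.mul_star_self_of_mem hU, mul_one]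

theorem add_algebraMap_mem_closedUnitaryOrbit (hS : S ∈ closedUnitaryOrbit T) (c : ℝ) :
    S + algebraMap ℝ (Elem M) c ∈ closedUnitaryOrbit (T + algebraMap ℝ (Elem M) c) := by
  refine map_mem_closure (f := fun X => X + algebraMap ℝ (Elem M) c) (by fun_prop) hS ?_
  rintro X ⟨U, hU, rfl⟩
  exact ⟨U, hU, (conj_add_algebraMap hU T c).symm⟩

theorem abs_mul_mul_unitary {U V : Elem M} (hU : U ∈ unitary (Elem M)) (hV : V ∈ unitary (Elem M))
    (hT : 0 ≤ T) : CFC.abs (U * T * V) = star V * T * V := by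
  have hn : 0 ≤ star V * T * V := star_left_conjugate_nonneg hT V
  have hTs : star T = T := (IsSelfAdjoint.of_nonneg hT).star_eq
  rw [CFC.abs, ← CFC.sqrt_mul_self _ hn]
  congr 1
  calc star (U * T * V) * (U * T * V) = star V * T * (star U * U) * T * V := by
        rw [star_mul, star_mul, hTs]; simp only [mul_assoc]
    _ = star V * T * (V * star V) * T * V := by
        rw [Unitary.star_mul_self_of_mem hU, Unitary.mul_star_self_of_mem hV]
    _ = _ := by simp only [mul_assoc]

/-- On the orbit itself `|UTV| = V*TV`; norm continuity of the absolute value passes to the closure.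
-/
theorem abs_mem_closedUnitaryOrbit (hT : 0 ≤ T) (hS : S ∈ closedTwoSidedUnitaryOrbit T) :
    CFC.abs S ∈ closedUnitaryOrbit T := by
  refine map_mem_closure CFC.continuous_abs hS ?_
  rintro X ⟨U, hU, V, hV, rfl⟩
  exact ⟨star V, Unitary.star_mem hV, by rw [star_star, abs_mul_mul_unitary hU hV hT]⟩

end Orbits

/-! ### From Thompson's theorem to the Schur–Horn theorem -/

section CondExp

variable {𝒜 : StarSubalgebra ℂ (Elem M)} {E : Elem M →ₗ[ℂ] 𝒜}

theorem IsNormalCondExp.apply_algebraMap (hE : IsNormalCondExp 𝒜 E) (c : ℝ) :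
    (E (algebraMap ℝ (Elem M) c) : Elem M) = algebraMap ℝ (Elem M) c :=
  congrArg Subtype.val (hE.apply_coe (algebraMap ℝ 𝒜 c))

/-- Thompson's theorem forces the conditional expectation to preserve the trace. -/
theorem ThompsonTheorem.apply_condExp (hE : IsNormalCondExp 𝒜 E) (h : ThompsonTheorem τ 𝒜 E)
    (T : Elem M) : τ (E T : Elem M) = τ T := by
  -- `X` lies in its own orbit, so `E X` is submajorized by `X`; evaluate at `t = 1`.
  have key : ∀ X : Elem M, 0 ≤ X → (τ (E X : Elem M)).re ≤ (τ X).re := by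
    intro X hX
    have := (h X (E X)).mpr ⟨X, mem_closedTwoSidedUnitaryOrbit_self X, rfl⟩ 1 ⟨zero_le_one, le_rfl⟩
    rwa [integral_singularValueFn, integral_singularValueFn, CFC.abs_of_nonneg X hX,
      CFC.abs_of_nonneg (E X : Elem M) (hE.nonneg X hX)] at this
  -- The reverse inequality is `key` for the positive element `‖X‖ - X`, since `E` fixes scalars.
  have key' : ∀ X : Elem M, 0 ≤ X → (τ X).re ≤ (τ (E X : Elem M)).re := by
    intro X hX
    have := key _ (add_algebraMap_nonneg (IsSelfAdjoint.of_nonneg hX).neg le_rfl)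
    have e : (E (-X + algebraMap ℝ (Elem M) ‖-X‖) : Elem M)
        = -(E X : Elem M) + algebraMap ℝ (Elem M) ‖-X‖ := by
      rw [map_add, map_neg]; exact congrArg (-(E X : Elem M) + ·) (hE.apply_algebraMap ‖-X‖)
    rw [e, map_add, map_add, map_neg, map_neg, Complex.add_re, Complex.add_re, Complex.neg_re,
      Complex.neg_re] at this
    linarith
  have hlin : τ.toLinearMap ∘ₗ 𝒜.toSubalgebra.val.toLinearMap ∘ₗ E = τ.toLinearMap :=
    LinearMap.ext_on CStarAlgebra.span_nonneg fun X hX =>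
      Complex.ext (le_antisymm (key X hX) (key' X hX))
        ((τ.im_of_nonneg (hE.nonneg X hX)).trans (τ.im_of_nonneg hX).symm)
  exact congrArg (fun φ => φ T) hlin

theorem ThompsonTheorem.schurHornTheorem (hE : IsNormalCondExp 𝒜 E)
    (h : ThompsonTheorem τ 𝒜 E) : SchurHornTheorem τ 𝒜 E := by
  intro T A hT hA'
  have hA : IsSelfAdjoint (A : Elem M) := congrArg Subtype.val hA'
  set c : ℝ := max ‖T‖ ‖(A : Elem M)‖ with hc
  have hTc : 0 ≤ T + algebraMap ℝ (Elem M) c := add_algebraMap_nonneg hT (le_max_left _ _)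
  have hAc : 0 ≤ (A : Elem M) + algebraMap ℝ (Elem M) c :=
    add_algebraMap_nonneg hA (le_max_right _ _)
  -- For positive elements singular values are eigenvalues, and the shift adds the same `t * c` to
  -- both integrals.
  have hsub : Submajorized τ ((A + algebraMap ℝ 𝒜 c : 𝒜) : Elem M) (T + algebraMap ℝ (Elem M) c) ↔
      ∀ t ∈ Set.Icc (0 : ℝ) 1,
        ∫ s in (0 : ℝ)..t, eigenvalueFn τ (A : Elem M) s ≤ ∫ s in (0 : ℝ)..t, eigenvalueFn τ T s := by
    have e : ((A + algebraMap ℝ 𝒜 c : 𝒜) : Elem M) = (A : Elem M) + algebraMap ℝ (Elem M) c := rfl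
    rw [Submajorized, e, singularValueFn_of_nonneg τ hTc, singularValueFn_of_nonneg τ hAc]
    refine forall₂_congr fun t ht => ?_
    rw [integral_eigenvalueFn_add_algebraMap τ hT c ht,
      integral_eigenvalueFn_add_algebraMap τ hA c ht, add_le_add_iff_right]
  constructor
  · rintro ⟨hle, heq⟩
    have hsub' := hsub.mpr fun t ht => by
      rcases ht.2.lt_or_eq with h1 | rfl
      · exact hle t ⟨ht.1, h1⟩
      · exact heq.le
    obtain ⟨S, hS, hES⟩ := (h _ _).mp hsub'
    have hES' : (E S : Elem M) = (A : Elem M) + algebraMap ℝ (Elem M) c := congrArg Subtype.val hES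
    have habs := abs_mem_closedUnitaryOrbit hTc hS
    have hτA : (τ (A : Elem M)).re = (τ T).re := by
      rw [← integral_eigenvalueFn τ hA, ← integral_eigenvalueFn τ hT, heq]
    -- The traces of `|S|`, `T + c`, `A + c = E S` and `S` have the same real part.
    have hS' : S = CFC.abs S := by
      apply τ.eq_abs_of_re_apply_abs
      rw [apply_eq_of_mem_closedUnitaryOrbit τ habs, ← h.apply_condExp τ hE S, hES', map_add,
        map_add, Complex.add_re, Complex.add_re, hτA]
    rw [← hS'] at habs
    refine ⟨S + algebraMap ℝ (Elem M) (-c), ?_, ?_⟩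
    · have := add_algebraMap_mem_closedUnitaryOrbit habs (-c)
      rwa [add_assoc T, ← map_add, add_neg_cancel, map_zero, add_zero] at this
    · apply Subtype.ext
      rw [map_add]
      change (E S : Elem M) + (E (algebraMap ℝ (Elem M) (-c)) : Elem M) = A
      rw [hES', hE.apply_algebraMap, add_assoc, ← map_add, add_neg_cancel, map_zero, add_zero]
  · rintro ⟨S, hS, rfl⟩
    have hS' := add_algebraMap_mem_closedUnitaryOrbit hS c
    have hES : E (S + algebraMap ℝ (Elem M) c) = E S + algebraMap ℝ 𝒜 c := by
      rw [map_add]; exact congrArg (E S + ·) (hE.apply_coe (algebraMap ℝ 𝒜 c))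
    have hle := hsub.mp ((h _ _).mpr ⟨_, closedUnitaryOrbit_subset _ hS', hES⟩)
    refine ⟨fun t ht => hle t ⟨ht.1, ht.2.le⟩, ?_⟩
    rw [integral_eigenvalueFn τ hA, integral_eigenvalueFn τ hT,
      h.apply_condExp τ hE, apply_eq_of_mem_closedUnitaryOrbit τ hS]

end CondExp

end IIOne

theorem mainTheorem7 {H : Type*} [NormedAddCommGroup H] [InnerProductSpace ℂ H] [CompleteSpace H]
    (M : VonNeumannAlgebra H) (hM : IIOne.IsIIOneFactor M) (τ : IIOne.Trace M) :
    (∀ S T : IIOne.Elem M, 0 ≤ T →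
      (∀ s ∈ Set.Ico (0 : ℝ) 1, IIOne.singularValueFn τ S s = IIOne.singularValueFn τ T s) →
      τ S = τ T → 0 ≤ S) ∧
    (∀ (𝒜 : StarSubalgebra ℂ (IIOne.Elem M)) (E : IIOne.Elem M →ₗ[ℂ] 𝒜),
      IIOne.IsMASA 𝒜 → IIOne.IsNormalCondExp 𝒜 E →
      IIOne.ThompsonTheorem τ 𝒜 E → IIOne.SchurHornTheorem τ 𝒜 E) :=
  ⟨fun _ _ hT hμ hτ => IIOne.nonneg_of_singularValueFn_eq τ hT hμ hτ,
    fun _ _ _ hE h => IIOne.ThompsonTheorem.schurHornTheorem τ hE h⟩
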